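/- Let $d\ge 1$ be an integer and $r=\lceil\log_2 d\rceil$. For a finite set $V$ let $\Delta^V=\{\lambda\in\mathbb R^V_{\ge 0}:\sum_v\lambda_v=1\}$, and for $T\subseteq V$ let $P(T)=\{\lambda\in\Delta^V:\operatorname{supp}(\lambda)\subseteq T\}$. The SOS2 constraint on $d+1$ breakpoints is $\bigcup_{i=1}^d P(\{i,i+1\})\subseteq\Delta^{d+1}$. The binary reflected Gray code $K^r\in\{0,1\}^{2^r\times r}$ is defined recursively: $K^0$ is the $1\times 0$ matrix; the first $2^r$ rows of $K^{r+1}$ are the rows of $K^r$ with a $0$ appended, and the last $2^r$ rows are the rows of $K^r$ in reverse order with a $1$ appended. Put $C^r_{k,i}=\sum_{j=2}^k|K^r_{j,i}-K^r_{j-1,i}|$ and $Z^r_k=\mathscr A(C^r_k)$ with $\mathscr A(y)_i=y_i-\sum_{k=i+1}^r y_k$. Let $C$ and $Z$ consist of the first $d$ rows of $C^r$ and of $Z^r$. Write $\alpha^j=C^r_j$ for $1\le j\le d$, $\alpha^0=\alpha^1$ and $\alpha^{d+1}=\alpha^d$. For $H\in\mathbb Z^{d\times r}$ with rows $H_1,\dots,H_d$,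 let $Q(H)=\operatorname{Conv}\bigl(\bigcup_{i=1}^d P(\{i,i+1\})\times\{H_i\}\bigr)$. A mixed-integer formulation, given by linear constraints with rational coefficients on $(\lambda,y)$ together with $y\in\mathbb Z^r$ or $y\in\{0,1\}^r$, is a formulation of a set $S$ if its feasible set projects onto $S$ in the $\lambda$-space. It is ideal if moreover $y$ is integral at every extreme point of its LP relaxation (in which $y\in\mathbb Z^r$ is relaxed to $y\in\mathbb R^r$, and $y\in\{0,1\}^r$ to $y\in[0,1]^r$). Then: 1. For $H=C$ and for $H=Z$ the rows of $H$ are distinct, they are exactly the extreme points of their convex hull, and they are exactly the integer points of their convex hull. Moreover $Z\in\{0,1\}^{d\times r}$, and $\{\alpha^{j+1}-\alpha^j:1\le j<d\}$ is the set of unit vectors $\{\mathbf e^1,\dots,\mathbf e^r\}$. 2. (General integer zig-zag formulation, ZZI.) An ideal formulation of the SOS2 constraint on $d+1$ breakpoints is $$(\lambda,y)\in\Delta^{d+1}\times\mathbb Z^r,\qquad \sum_{v=1}^{d+1}\alpha^{v-1}_i\lambda_v\le y_i\le\sum_{v=1}^{d+1}\alpha^v_i\lambda_v\quad(1\le i\le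 r),$$ and its LP relaxation equals $Q(C)$. 3. (Binary zig-zag formulation, ZZB.) An ideal formulation of the SOS2 constraint on $d+1$ breakpoints is $$(\lambda,y)\in\Delta^{d+1}\times\{0,1\}^r,\qquad \sum_{v=1}^{d+1}\alpha^{v-1}_i\lambda_v\le y_i+\sum_{k=i+1}^r 2^{k-i-1}y_k\le\sum_{v=1}^{d+1}\alpha^v_i\lambda_v\quad(1\le i\le r),$$ and its LP relaxation equals $Q(Z)$. 4. Both formulations have logarithmic size: each has $\lceil\log_2 d\rceil$ integer variables and $2\lceil\log_2 d\rceil$ linear inequalities, apart from the constraint $\lambda\in\Delta^{d+1}$ and the bounds on binary variables. -/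

import Mathlib

open scoped BigOperators

noncomputable section

namespace ZigZag

/-! ### Combinatorial disjunctive constraints and SOS2 -/

/-- `P(T)`: the points of the unit simplex `Δ^V` whose support lies in `T`. -/
def face {V : Type*} [Fintype V] (T : Set V) : Set (V → ℝ) :=
  {x | x ∈ stdSimplex ℝ V ∧ Function.support x ⊆ T}

/-- The combinatorial disjunctive constraint `⋃ i, P(T i)`. -/
def disjunction {V ι : Type*} [Fintype V] (T : ι → Set V) : Set (V → ℝ) :=
  ⋃ i, face (T i)

/-- The family `({i, i+1})` for `i = 1, …, d`. The breakpoints `1, …, d+1` are indexed by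
`Fin (d + 1)` and the pieces `1, …, d` by `Fin d`: an element `v` stands for the number
`(v : ℕ) + 1`. -/
def sos2Family (d : ℕ) (i : Fin d) : Set (Fin (d + 1)) := {i.castSucc, i.succ}

/-- The SOS2 constraint on `d + 1` breakpoints. -/
def sos2 (d : ℕ) : Set (Fin (d + 1) → ℝ) := disjunction (sos2Family d)

/-! ### Encodings and embeddings -/

/-- An integer vector, seen in real space. -/
def toReal {r : ℕ} (c : Fin r → ℤ) : Fin r → ℝ := fun i => (c i : ℝ)

/-- The set of rows of an integer matrix, seen in real space. -/
def rows {d r : ℕ} (H : Fin d → Fin r → ℤ) : Set (Fin r → ℝ) :=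
  Set.range fun k => toReal (H k)

/-- General integer encodings: the rows are distinct, in convex position, and they are
all the integer points of their convex hull. -/
structure IsIntegerEncoding {d r : ℕ} (H : Fin d → Fin r → ℤ) : Prop where
  distinct : Function.Injective H
  convexPosition : (convexHull ℝ (rows H)).extremePoints ℝ = rows H
  latticeEmpty : convexHull ℝ (rows H) ∩ Set.range toReal = rows H

/-- The embedding `Em(T, H) = ⋃ i, P(T i) × {H i}`. -/
def embedding {V : Type*} [Fintype V] {d r : ℕ} (T : Fin d → Set V)
    (H : Fin d → Fin r → ℤ) : Set ((V → ℝ) × (Fin r → ℝ)) :=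
  ⋃ i, face (T i) ×ˢ {toReal (H i)}

/-- `Q(T, H)`, the convex hull of the embedding. -/
def embeddingHull {V : Type*} [Fintype V] {d r : ℕ} (T : Fin d → Set V)
    (H : Fin d → Fin r → ℤ) : Set ((V → ℝ) × (Fin r → ℝ)) :=
  convexHull ℝ (embedding T H)

/-! ### Mixed-integer formulations -/

/-- A linear inequality `∑ v, a v * x v + ∑ j, b j * y j ≤ c` with rational coefficients. -/
structure LinIneq (V J : Type*) where
  a : V → ℚ
  b : J → ℚ
  c : ℚ

/-- The inequality holds at the point `p = (x, y)`. -/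
def LinIneq.Holds {V J : Type*} [Fintype V] [Fintype J] (e : LinIneq V J)
    (p : (V → ℝ) × (J → ℝ)) : Prop :=
  ∑ v, (e.a v : ℝ) * p.1 v + ∑ j, (e.b j : ℝ) * p.2 j ≤ (e.c : ℝ)

/-- A mixed-integer linear formulation in continuous variables `x ∈ Δ^V` and integer
variables `y` indexed by `J`, those in `binary` restricted to `{0, 1}`, with general
linear inequalities indexed by `I`. -/
structure MIPFormulation (V J I : Type*) where
  binary : Set J
  ineq : I → LinIneq V J

namespace MIPFormulation

variable {V J I : Type*} [Fintype V] [Fintype J] [Fintype I]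

/-- The number of integer (or binary) variables. -/
def numIntegerVars (_F : MIPFormulation V J I) : ℕ := Fintype.card J

/-- The number of general inequalities (the simplex constraint and the bounds of the
binary variables are not counted). -/
def numIneqs (_F : MIPFormulation V J I) : ℕ := Fintype.card I

/-- The LP relaxation. -/
def relaxation (F : MIPFormulation V J I) : Set ((V → ℝ) × (J → ℝ)) :=
  {p | p.1 ∈ stdSimplex ℝ V ∧ (∀ j ∈ F.binary, 0 ≤ p.2 j ∧ p.2 j ≤ 1) ∧
    ∀ i, (F.ineq i).Holds p}

/-- The feasible set: the points of the LP relaxation with integer `y`. -/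
def feasible (F : MIPFormulation V J I) : Set ((V → ℝ) × (J → ℝ)) :=
  {p | p ∈ F.relaxation ∧ ∀ j, ∃ n : ℤ, p.2 j = n}

/-- `F` is a formulation of `S`: the feasible set projects onto `S`. -/
def IsFormulationOf (F : MIPFormulation V J I) (S : Set (V → ℝ)) : Prop :=
  Prod.fst '' F.feasible = S

/-- `F` is an ideal formulation of `S`: it is a formulation of `S`, and `y` is integer at
every extreme point of the LP relaxation. -/
def IsIdealFormulationOf (F : MIPFormulation V J I) (S : Set (V → ℝ)) : Prop :=
  F.IsFormulationOf S ∧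
    ∀ p ∈ F.relaxation.extremePoints ℝ, ∀ j, ∃ n : ℤ, p.2 j = n

end MIPFormulation

/-! ### The codes

Rows are numbered `1, …, 2 ^ r`; values at other row numbers are irrelevant. The columns
`1, …, r` are indexed by `Fin r`. -/

/-- Row `k` of the binary reflected Gray code `K^r`: the first `2 ^ r` rows of `K^(r+1)` are
those of `K^r` with a `0` appended, the others are those of `K^r` in reverse order with a
`1` appended. -/
def grayCode : (r : ℕ) → ℕ → Fin r → ℤ
  | 0, _ => Fin.elim0
  | r + 1, k =>
    if k ≤ 2 ^ r then Fin.snoc (α := fun _ => ℤ) (grayCode r k) 0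
    else Fin.snoc (α := fun _ => ℤ) (grayCode r (2 ^ (r + 1) + 1 - k)) 1

/-- Row `k` of `C^r`: the number of value changes in each column of `K^r` up to row `k`. -/
def integerCode (r k : ℕ) : Fin r → ℤ :=
  fun i => ∑ j ∈ Finset.Icc 2 k, |grayCode r j i - grayCode r (j - 1) i|

/-- The linear map `𝒜(y) i = y i - ∑ k > i, y k`. -/
def zigzagMap (r : ℕ) : (Fin r → ℤ) →ₗ[ℤ] (Fin r → ℤ) where
  toFun y i := y i - ∑ k ∈ Finset.Ioi i, y k
  map_add' y z := by
    funext i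
    simp only [Pi.add_apply, Finset.sum_add_distrib]
    ring
  map_smul' c y := by
    funext i
    simp only [Pi.smul_apply, smul_eq_mul, ← Finset.mul_sum, RingHom.id_apply]
    ring

/-- Row `k` of `Z^r = 𝒜(C^r)`. -/
def binaryCode (r k : ℕ) : Fin r → ℤ := zigzagMap r (integerCode r k)

/-- The code length `⌈log₂ d⌉`. -/
abbrev codeLength (d : ℕ) : ℕ := Nat.clog 2 d

/-- The general integer zig-zag encoding of `d` pieces: the first `d` rows of `C^r`. -/
def integerEncoding (d : ℕ) : Fin d → Fin (codeLength d) → ℤ :=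
  fun k => integerCode (codeLength d) ((k : ℕ) + 1)

/-- The binary zig-zag encoding of `d` pieces: the first `d` rows of `Z^r`. -/
def binaryEncoding (d : ℕ) : Fin d → Fin (codeLength d) → ℤ :=
  fun k => binaryCode (codeLength d) ((k : ℕ) + 1)

/-! ### The two formulations -/

/-- `α^j` for `0 ≤ j ≤ d + 1`: row `j` of `C^r` for `1 ≤ j ≤ d`, with `α^0 = α^1` and
`α^(d+1) = α^d`. -/
def alpha (d j : ℕ) : Fin (codeLength d) → ℤ :=
  if j = 0 then integerCode (codeLength d) 1
  else if j = d + 1 then integerCode (codeLength d) d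
  else integerCode (codeLength d) j

/-- The general integer zig-zag formulation: `x ∈ Δ^(d+1)`, `y ∈ ℤ^r` and
`∑ v, α^(v-1) i * x v ≤ y i ≤ ∑ v, α^v i * x v` for every `i`. -/
def ZZI (d : ℕ) : MIPFormulation (Fin (d + 1)) (Fin (codeLength d))
    (Fin (codeLength d) ⊕ Fin (codeLength d)) where
  binary := ∅
  ineq
    | .inl i => { a := fun v => alpha d (v : ℕ) i, b := -Pi.single i 1, c := 0 }
    | .inr i => { a := fun v => -alpha d ((v : ℕ) + 1) i, b := Pi.single i 1, c := 0 }

/-- The coefficients of `y i + ∑ k > i, 2 ^ (k - i - 1) * y k`. -/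
def binaryCoeff {r : ℕ} (i k : Fin r) : ℚ :=
  if k = i then 1 else if i < k then 2 ^ ((k : ℕ) - (i : ℕ) - 1) else 0

/-- The binary zig-zag formulation: `x ∈ Δ^(d+1)`, `y ∈ {0,1}^r` and
`∑ v, α^(v-1) i * x v ≤ y i + ∑ k > i, 2^(k-i-1) * y k ≤ ∑ v, α^v i * x v` for every `i`. -/
def ZZB (d : ℕ) : MIPFormulation (Fin (d + 1)) (Fin (codeLength d))
    (Fin (codeLength d) ⊕ Fin (codeLength d)) where
  binary := Set.univ
  ineq
    | .inl i => { a := fun v => alpha d (v : ℕ) i, b := -binaryCoeff i, c := 0 }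
    | .inr i => { a := fun v => -alpha d ((v : ℕ) + 1) i, b := binaryCoeff i, c := 0 }

/-- The LP relaxation of `ZZI`, written out. -/
theorem mem_relaxation_ZZI (d : ℕ) (x : Fin (d + 1) → ℝ) (y : Fin (codeLength d) → ℝ) :
    (x, y) ∈ (ZZI d).relaxation ↔ x ∈ stdSimplex ℝ (Fin (d + 1)) ∧
      ∀ i, ∑ v : Fin (d + 1), (alpha d (v : ℕ) i : ℝ) * x v ≤ y i ∧
        y i ≤ ∑ v : Fin (d + 1), (alpha d ((v : ℕ) + 1) i : ℝ) * x v := by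
  have h : ∀ i : Fin (codeLength d),
      ∑ j, (((Pi.single i 1 : Fin (codeLength d) → ℚ) j : ℚ) : ℝ) * y j = y i := by
    intro i
    rw [Finset.sum_eq_single i] <;> simp +contextual [Pi.single_apply]
  simp only [MIPFormulation.relaxation, Set.mem_ofPred_eq, Sum.forall, LinIneq.Holds, ZZI,
    Set.mem_empty_iff_false, Pi.neg_apply, Rat.cast_neg, Rat.cast_intCast, Rat.cast_zero,
    neg_mul, Finset.sum_neg_distrib, h, false_imp_iff, implies_true, true_and]
  refine and_congr_right fun _ => ?_
  rw [← forall_and]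
  refine forall_congr' fun i => ?_
  constructor <;> rintro ⟨h1, h2⟩ <;> constructor <;> linarith

/-- The LP relaxation of `ZZB`, written out. -/
theorem mem_relaxation_ZZB (d : ℕ) (x : Fin (d + 1) → ℝ) (y : Fin (codeLength d) → ℝ) :
    (x, y) ∈ (ZZB d).relaxation ↔ x ∈ stdSimplex ℝ (Fin (d + 1)) ∧
      (∀ i, 0 ≤ y i ∧ y i ≤ 1) ∧
      ∀ i, ∑ v : Fin (d + 1), (alpha d (v : ℕ) i : ℝ) * x v
            ≤ y i + ∑ k ∈ Finset.Ioi i, 2 ^ ((k : ℕ) - (i : ℕ) - 1) * y k ∧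
        y i + ∑ k ∈ Finset.Ioi i, 2 ^ ((k : ℕ) - (i : ℕ) - 1) * y k
            ≤ ∑ v : Fin (d + 1), (alpha d ((v : ℕ) + 1) i : ℝ) * x v := by
  have h : ∀ i : Fin (codeLength d), ∑ j, ((binaryCoeff i j : ℚ) : ℝ) * y j =
      y i + ∑ k ∈ Finset.Ioi i, 2 ^ ((k : ℕ) - (i : ℕ) - 1) * y k := by
    intro i
    have h1 : Finset.Ioi i = Finset.univ.filter (fun k => i < k) := by
      ext k
      simp
    have h2 : y i = ∑ k, if k = i then y k else 0 := by simp
    rw [h1, Finset.sum_filter]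
    refine Eq.trans ?_ (congrArg (· + _) h2.symm)
    rw [← Finset.sum_add_distrib]
    refine Finset.sum_congr rfl fun k _ => ?_
    unfold binaryCoeff
    by_cases hk : k = i
    · simp [hk]
    · by_cases hk' : i < k <;> simp [hk, hk']
  simp only [MIPFormulation.relaxation, Set.mem_ofPred_eq, Sum.forall, LinIneq.Holds, ZZB,
    Set.mem_univ, Pi.neg_apply, Rat.cast_neg, Rat.cast_intCast, Rat.cast_zero,
    neg_mul, Finset.sum_neg_distrib, h, true_imp_iff]
  refine and_congr_right fun _ => and_congr_right fun _ => ?_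
  rw [← forall_and]
  refine forall_congr' fun i => ?_
  constructor <;> rintro ⟨h1, h2⟩ <;> constructor <;> linarith

end ZigZag

end

namespace ZigZag

/-! ### Closed forms of the codes -/

/-! Number the rows by `n = k - 1`. The reflection in the Gray code yields a closed form: column `i`
of the Gray code is the parity of `⌊(n + 2^i) / 2^(i+1)⌋`, and counting its changes gives that
quotient itself. The quotient equals `⌊n / 2^i⌋ - ⌊n / 2^(i+1)⌋`, so applying `zigzagMap`
telescopes, and the binary zig-zag code is just the binary expansion of `n`
(`binaryCode_succ_apply`). Its rows are distinct vertices of the unit cube, hence form an integer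
encoding. The integer code is their image under `unzigzag`, a unitriangular integer map, which
preserves extreme points and the lattice.

Any formulation whose relaxation is the embedding hull of an integer encoding is ideal
(`isIdealFormulationOf_disjunction`). What remains is to identify the relaxations. Consecutive
vectors `α` differ by zero or one unit vector, so over each vertex of the simplex the box `[α^(v-1),
α^v]` is only a segment, whose ends come from pieces containing that breakpoint
(`single_interpolation_mem`). A point of the relaxation of `ZZI` is an average of points on such
segments, and the result for `ZZB` follows by pulling back along `unzigzag`. -/

/-- Reversing the order of the rows sends the quotient `q` to `2^(r-i) - q`, which has the same
parity because `i < r`. This is the reflection step of the Gray code. -/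
theorem two_pow_sub_div {r i n : ℕ} (hi : i < r) (hn : n < 2 ^ (r + 1)) :
    ((2 ^ (r + 1) - 1 - n + 2 ^ i) / 2 ^ (i + 1)) % 2 = ((n + 2 ^ i) / 2 ^ (i + 1)) % 2 := by
  obtain ⟨s, rfl⟩ : ∃ s, r = i + 1 + s := ⟨r - (i + 1), by omega⟩
  have hm : 0 < 2 ^ i := by positivity
  have hp : 2 ^ (i + 1 + s + 1) = 2 ^ (i + 1) * (2 * 2 ^ s) := by ring
  have hp1 : 2 ^ (i + 1) = 2 * 2 ^ i := by ring
  have ht := Nat.mod_lt (n + 2 ^ i) (y := 2 ^ (i + 1)) (by positivity)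
  have hq := Nat.div_add_mod (n + 2 ^ i) (2 ^ (i + 1))
  set q := (n + 2 ^ i) / 2 ^ (i + 1) with hqd
  set t := (n + 2 ^ i) % 2 ^ (i + 1)
  have hle : q ≤ 2 * 2 ^ s := by
    rw [hqd, ← Nat.lt_succ_iff, Nat.div_lt_iff_lt_mul (by positivity), Nat.succ_mul,
      mul_comm, ← hp]
    omega
  obtain ⟨u, hu⟩ := Nat.exists_eq_add_of_le hle
  have h1 : 2 ^ (i + 1 + s + 1) - 1 - n + 2 ^ i
      = 2 ^ (i + 1) * u + (2 ^ (i + 1) - 1 - t) := by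
    have h2 : 2 ^ (i + 1) * (2 * 2 ^ s) = 2 ^ (i + 1) * q + 2 ^ (i + 1) * u := by
      rw [hu, mul_add]
    omega
  rw [h1, Nat.mul_add_div (by positivity), Nat.div_eq_of_lt (a := 2 ^ (i + 1) - 1 - t) (by omega)]
  omega

theorem grayCode_succ_apply (r n : ℕ) (hn : n < 2 ^ r) (i : Fin r) :
    grayCode r (n + 1) i = (((n + 2 ^ (i : ℕ)) / 2 ^ ((i : ℕ) + 1) % 2 : ℕ) : ℤ) := by
  induction r generalizing n with
  | zero => exact i.elim0
  | succ r ih =>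
    have hpow : 2 ^ (r + 1) = 2 * 2 ^ r := by ring
    by_cases hle : n + 1 ≤ 2 ^ r
    · simp only [grayCode, if_pos hle]
      induction i using Fin.lastCases with
      | last =>
        rw [Fin.snoc_last, Fin.val_last, Nat.div_eq_of_lt (by omega)]
        rfl
      | cast i => simpa [Fin.snoc_castSucc] using ih n (by omega) i
    · simp only [grayCode, if_neg hle]
      induction i using Fin.lastCases with
      | last =>
        rw [Fin.snoc_last, Fin.val_last,
          Nat.div_eq_of_lt_le (k := 1) (by omega) (by omega)]
        rfl
      | cast i =>
        have h : 2 ^ (r + 1) + 1 - (n + 1) = (2 ^ (r + 1) - 1 - n) + 1 := by omega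
        rw [Fin.snoc_castSucc, h, ih _ (by omega) i, Fin.val_castSucc,
          two_pow_sub_div i.isLt hn]

theorem integerCode_one (r : ℕ) : integerCode r 1 = 0 := by
  funext i
  simp [integerCode]

/-- From one row to the next the quotient in the closed form grows by at most one, and its parity,
the Gray code entry, flips exactly when it grows. -/
theorem integerCode_succ_sub (r n : ℕ) (hn : n + 1 < 2 ^ r) (i : Fin r) :
    integerCode r (n + 2) i - integerCode r (n + 1) i =
      if 2 ^ ((i : ℕ) + 1) ∣ n + 1 + 2 ^ (i : ℕ) then 1 else 0 := by
  have h : integerCode r (n + 2) i - integerCode r (n + 1) i =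
      |grayCode r (n + 1 + 1) i - grayCode r (n + 1) i| := by
    unfold integerCode
    rw [Finset.sum_Icc_succ_top (by omega)]
    simp
  rw [h, grayCode_succ_apply r _ hn, grayCode_succ_apply r n (by omega),
    show n + 1 + 2 ^ (i : ℕ) = n + 2 ^ (i : ℕ) + 1 by ring, Nat.succ_div]
  split_ifs
  · rcases Nat.mod_two_eq_zero_or_one ((n + 2 ^ (i : ℕ)) / 2 ^ ((i : ℕ) + 1)) with h | h <;>
      simp [Nat.add_mod, h]
  · simp

theorem integerCode_succ_apply (r n : ℕ) (hn : n < 2 ^ r) (i : Fin r) :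
    integerCode r (n + 1) i = (((n + 2 ^ (i : ℕ)) / 2 ^ ((i : ℕ) + 1) : ℕ) : ℤ) := by
  induction n with
  | zero =>
    rw [integerCode_one, zero_add, Nat.div_eq_of_lt (Nat.pow_lt_pow_right one_lt_two (by omega))]
    rfl
  | succ n ih =>
    have h := integerCode_succ_sub r n hn i
    rw [ih (by omega)] at h
    rw [show n + 1 + 2 ^ (i : ℕ) = n + 2 ^ (i : ℕ) + 1 by ring] at h ⊢
    rw [Nat.succ_div]
    push_cast at h ⊢
    linarith

theorem integerCode_mono (r : ℕ) : Monotone (integerCode r) := fun _ _ h _ =>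
  Finset.sum_le_sum_of_subset_of_nonneg (Finset.Icc_subset_Icc_right h) fun _ _ _ => abs_nonneg _

/-- Compare 2-adic valuations. Consequently the step from row `j` to row `j + 1` changes only the
column indexed by the valuation of `j`. -/
theorem two_pow_succ_dvd_iff {a i s : ℕ} :
    2 ^ (i + 1) ∣ 2 ^ a * (2 * s + 1) + 2 ^ i ↔ i = a := by
  constructor
  · intro h
    rcases lt_trichotomy i a with hlt | rfl | hlt
    · have h1 : 2 ^ (i + 1) ∣ 2 ^ a * (2 * s + 1) := Dvd.dvd.mul_right (pow_dvd_pow 2 hlt) _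
      have h2 := (Nat.dvd_add_right h1).1 h
      rw [Nat.pow_dvd_pow_iff_le_right (by norm_num)] at h2
      omega
    · rfl
    · have h1 : 2 ^ (a + 1) ∣ 2 ^ i := pow_dvd_pow 2 hlt
      have h2 := (Nat.dvd_add_left h1).1 ((pow_dvd_pow 2 (by omega)).trans h)
      rw [pow_succ, Nat.mul_dvd_mul_iff_left (by positivity)] at h2
      omega
  · rintro rfl
    exact ⟨s + 1, by ring⟩

theorem integerCode_succ_sub_eq_single {r a s : ℕ} (h : 2 ^ a * (2 * s + 1) < 2 ^ r)
    (ha : a < r) :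
    integerCode r (2 ^ a * (2 * s + 1) + 1) - integerCode r (2 ^ a * (2 * s + 1)) =
      Pi.single ⟨a, ha⟩ 1 := by
  funext i
  obtain ⟨n, hn⟩ := Nat.exists_eq_succ_of_ne_zero (n := 2 ^ a * (2 * s + 1)) (by positivity)
  rw [Nat.succ_eq_add_one] at hn
  have h1 := integerCode_succ_sub r n (hn ▸ h) i
  simp only [← hn, two_pow_succ_dvd_iff] at h1
  rw [hn] at h1
  rw [Pi.sub_apply, hn, h1, Pi.single_apply]
  simp [Fin.ext_iff]

theorem exists_integerCode_succ_sub_eq_single {r j : ℕ} (hj : 1 ≤ j) (hjr : j < 2 ^ r) :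
    ∃ i, integerCode r (j + 1) - integerCode r j = Pi.single i 1 := by
  obtain ⟨a, m, ⟨s, rfl⟩, rfl⟩ := Nat.exists_eq_two_pow_mul_odd (n := j) (by omega)
  have ha : a < r := by
    rw [← Nat.pow_lt_pow_iff_right (a := 2) one_lt_two]
    exact lt_of_le_of_lt (Nat.le_mul_of_pos_right _ (by omega)) hjr
  exact ⟨⟨a, ha⟩, integerCode_succ_sub_eq_single hjr ha⟩

theorem sum_Ioi_sub {r : ℕ} (g : ℕ → ℤ) (i : Fin r) :
    ∑ k ∈ Finset.Ioi i, (g k - g (k + 1)) = g (i + 1) - g r := by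
  have h : ∑ k ∈ Finset.Ioi i, (g k - g (k + 1)) = ∑ k ∈ Finset.Ioo (i : ℕ) r, (g k - g (k + 1)) := by
    rw [← Fin.map_valEmbedding_Ioi, Finset.sum_map]
    rfl
  have h2 : Finset.Ioo (i : ℕ) r = Finset.Ico ((i : ℕ) + 1) r := rfl
  rw [h, h2, ← neg_sub (g r), ← Finset.sum_Ico_sub g i.isLt, ← Finset.sum_neg_distrib]
  simp

theorem sub_div_two_pow (n i : ℕ) :
    (((n + 2 ^ i) / 2 ^ (i + 1) : ℕ) : ℤ) = (n / 2 ^ i : ℕ) - (n / 2 ^ (i + 1) : ℕ) := by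
  have h : (n + 2 ^ i) / 2 ^ (i + 1) = (n / 2 ^ i + 1) / 2 := by
    rw [pow_succ, ← Nat.div_div_eq_div_mul, Nat.add_div_right _ (by positivity)]
  rw [h, pow_succ, ← Nat.div_div_eq_div_mul]
  omega

theorem binaryCode_succ_apply (r n : ℕ) (hn : n < 2 ^ r) (i : Fin r) :
    binaryCode r (n + 1) i = ((n / 2 ^ (i : ℕ) % 2 : ℕ) : ℤ) := by
  change integerCode r (n + 1) i - ∑ k ∈ Finset.Ioi i, integerCode r (n + 1) k = _
  simp only [integerCode_succ_apply r n hn, sub_div_two_pow]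
  rw [sum_Ioi_sub (fun k => ((n / 2 ^ k : ℕ) : ℤ)) i]
  simp only [Nat.div_eq_of_lt hn, pow_succ, ← Nat.div_div_eq_div_mul]
  omega

theorem binaryCode_injOn {r m n : ℕ} (hm : m < 2 ^ r) (hn : n < 2 ^ r)
    (h : binaryCode r (m + 1) = binaryCode r (n + 1)) : m = n := by
  refine Nat.eq_of_testBit_eq fun i => ?_
  by_cases hi : i < r
  · have h1 := congrFun h ⟨i, hi⟩
    rw [binaryCode_succ_apply r m hm, binaryCode_succ_apply r n hn] at h1
    rw [Nat.testBit_eq_decide_div_mod_eq, Nat.testBit_eq_decide_div_mod_eq]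
    simp only [Nat.cast_inj] at h1
    rw [h1]
  · have hle : 2 ^ r ≤ 2 ^ i := Nat.pow_le_pow_right (by norm_num) (by omega)
    rw [Nat.testBit_lt_two_pow (hm.trans_le hle), Nat.testBit_lt_two_pow (hn.trans_le hle)]

/-! ### The inverse of `zigzagMap` over the reals -/

/-- The linear map `y ↦ (y i + ∑ k > i, 2 ^ (k - i - 1) * y k)`. -/
def unzigzag (r : ℕ) : (Fin r → ℝ) →ₗ[ℝ] (Fin r → ℝ) where
  toFun y i := y i + ∑ k ∈ Finset.Ioi i, 2 ^ ((k : ℕ) - (i : ℕ) - 1) * y k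
  map_add' y z := by
    funext i
    simp only [Pi.add_apply, mul_add, Finset.sum_add_distrib]
    ring
  map_smul' c y := by
    funext i
    simp only [Pi.smul_apply, smul_eq_mul, mul_add, Finset.mul_sum, RingHom.id_apply,
      mul_left_comm c]

theorem unzigzag_apply {r : ℕ} (y : Fin r → ℝ) (i : Fin r) :
    unzigzag r y i = y i + ∑ k ∈ Finset.Ioi i, 2 ^ ((k : ℕ) - (i : ℕ) - 1) * y k := rfl

/-- Back substitution from the last coordinate, as the map is unitriangular with integer entries.
The trivial subgroup gives injectivity, and the integers give integrality of preimages. -/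
theorem mem_of_unzigzag_mem {r : ℕ} (S : AddSubgroup ℝ) (y : Fin r → ℝ)
    (h : ∀ i, unzigzag r y i ∈ S) (i : Fin r) : y i ∈ S := by
  induction i using WellFoundedGT.induction with
  | ind i ih =>
    have h1 : y i = unzigzag r y i - ∑ k ∈ Finset.Ioi i, 2 ^ ((k : ℕ) - (i : ℕ) - 1) * y k := by
      rw [unzigzag_apply]
      ring
    rw [h1]
    refine S.sub_mem (h i) (S.sum_mem fun k hk => ?_)
    have h2 := S.nsmul_mem (ih k (Finset.mem_Ioi.1 hk)) (2 ^ ((k : ℕ) - (i : ℕ) - 1))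
    simpa using h2

theorem unzigzag_injective (r : ℕ) : Function.Injective (unzigzag r) := by
  rw [injective_iff_map_eq_zero]
  intro y hy
  funext i
  exact AddSubgroup.mem_bot.1 (mem_of_unzigzag_mem ⊥ y (fun i => by rw [hy]; simp) i)

theorem unzigzag_binaryCode (r n : ℕ) (hn : n < 2 ^ r) :
    unzigzag r (toReal (binaryCode r (n + 1))) = toReal (integerCode r (n + 1)) := by
  funext i
  have hint : binaryCode r (n + 1) i +
      ∑ k ∈ Finset.Ioi i, 2 ^ ((k : ℕ) - (i : ℕ) - 1) * binaryCode r (n + 1) k =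
        integerCode r (n + 1) i := by
    -- Bit `k` is `⌊n / 2^k⌋ - 2 ⌊n / 2^(k+1)⌋`; the factor 2 matches the growth of the weights, so
    -- the weighted sum telescopes.
    have h : ∀ k ∈ Finset.Ioi i, 2 ^ ((k : ℕ) - (i : ℕ) - 1) * binaryCode r (n + 1) k =
        2 ^ ((k : ℕ) - (i : ℕ) - 1) * ((n / 2 ^ (k : ℕ) : ℕ) : ℤ) -
          2 ^ ((k : ℕ) + 1 - (i : ℕ) - 1) * ((n / 2 ^ ((k : ℕ) + 1) : ℕ) : ℤ) := by
      intro k hk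
      have hik : i < k := Finset.mem_Ioi.1 hk
      rw [Fin.lt_def] at hik
      have hdiv : ((n / 2 ^ (k : ℕ) % 2 : ℕ) : ℤ) =
          (n / 2 ^ (k : ℕ) : ℕ) - 2 * (n / 2 ^ ((k : ℕ) + 1) : ℕ) := by
        rw [pow_succ, ← Nat.div_div_eq_div_mul]
        omega
      rw [binaryCode_succ_apply r n hn, hdiv,
        show (k : ℕ) + 1 - (i : ℕ) - 1 = (k : ℕ) - (i : ℕ) - 1 + 1 by omega]
      ring
    rw [Finset.sum_congr rfl h,
      sum_Ioi_sub (fun k => 2 ^ (k - (i : ℕ) - 1) * ((n / 2 ^ k : ℕ) : ℤ)) i,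
      binaryCode_succ_apply r n hn, integerCode_succ_apply r n hn, sub_div_two_pow,
      Nat.div_eq_of_lt hn, pow_succ, ← Nat.div_div_eq_div_mul]
    simp only [Nat.add_sub_cancel_left, Nat.sub_self]
    omega
  rw [unzigzag_apply]
  simp only [toReal]
  exact_mod_cast hint

theorem unzigzag_binaryEncoding {d : ℕ} (k : Fin d) :
    unzigzag _ (toReal (binaryEncoding d k)) = toReal (integerEncoding d k) :=
  unzigzag_binaryCode _ _ (k.isLt.trans_le (Nat.le_pow_clog one_lt_two d))

/-! ### Encodings -/

theorem toReal_injective {r : ℕ} : Function.Injective (toReal (r := r)) := fun _ _ h =>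
  funext fun i => Int.cast_injective (congrFun h i)

theorem mem_extremePoints_unitCube {r : ℕ} {c : Fin r → ℤ} (hc : ∀ i, c i = 0 ∨ c i = 1) :
    toReal c ∈ (Set.univ.pi fun _ : Fin r => Set.Icc (0 : ℝ) 1).extremePoints ℝ := by
  rw [extremePoints_pi, Set.mem_univ_pi]
  intro i
  refine ⟨by rcases hc i with h | h <;> simp [toReal, h], ?_⟩
  rintro x ⟨hx0, hx1⟩ y ⟨hy0, hy1⟩ ⟨a, b, ha, hb, hab, h⟩
  simp only [smul_eq_mul] at h
  rcases hc i with hi | hi <;> simp only [toReal, hi, Int.cast_zero, Int.cast_one] at h ⊢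
  · nlinarith [mul_nonneg ha.le hx0, mul_nonneg hb.le hy0]
  · nlinarith [mul_nonneg ha.le (sub_nonneg.2 hx1), mul_nonneg hb.le (sub_nonneg.2 hy1)]

theorem convexHull_rows_subset_unitCube {d r : ℕ} {H : Fin d → Fin r → ℤ}
    (h01 : ∀ k i, H k i = 0 ∨ H k i = 1) :
    convexHull ℝ (rows H) ⊆ Set.univ.pi fun _ : Fin r => Set.Icc (0 : ℝ) 1 := by
  refine convexHull_min ?_ (convex_pi fun _ _ => convex_Icc 0 1)
  rintro _ ⟨k, rfl⟩
  exact (mem_extremePoints_unitCube (h01 k)).1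

/-- The hull lies in the unit cube, whose integer points are all vertices. A vertex of the cube
lying in the hull is extreme there, hence is a row. -/
theorem isIntegerEncoding_of_zero_one {d r : ℕ} {H : Fin d → Fin r → ℤ}
    (hinj : Function.Injective H) (h01 : ∀ k i, H k i = 0 ∨ H k i = 1) :
    IsIntegerEncoding H where
  distinct := hinj
  convexPosition := by
    refine extremePoints_convexHull_subset.antisymm ?_
    rintro _ ⟨k, rfl⟩
    exact inter_extremePoints_subset_extremePoints_of_subset (convexHull_rows_subset_unitCube h01)
      ⟨subset_convexHull ℝ _ ⟨k, rfl⟩, mem_extremePoints_unitCube (h01 k)⟩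
  latticeEmpty := by
    apply Set.Subset.antisymm
    · rintro _ ⟨hy, c, rfl⟩
      have hcube := convexHull_rows_subset_unitCube h01 hy
      have hc : ∀ i, c i = 0 ∨ c i = 1 := by
        intro i
        obtain ⟨h0, h1⟩ := hcube i (Set.mem_univ i)
        simp only [toReal] at h0 h1
        have h0' : 0 ≤ c i := by exact_mod_cast h0
        have h1' : c i ≤ 1 := by exact_mod_cast h1
        omega
      exact extremePoints_convexHull_subset
        (inter_extremePoints_subset_extremePoints_of_subset (convexHull_rows_subset_unitCube h01)
          ⟨hy, mem_extremePoints_unitCube hc⟩)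
    · rintro _ ⟨k, rfl⟩
      exact ⟨subset_convexHull ℝ _ ⟨k, rfl⟩, H k, rfl⟩

theorem binaryEncoding_zero_or_one {d : ℕ} (k : Fin d) (i : Fin (codeLength d)) :
    binaryEncoding d k i = 0 ∨ binaryEncoding d k i = 1 := by
  unfold binaryEncoding
  rw [binaryCode_succ_apply _ _ (k.isLt.trans_le (Nat.le_pow_clog one_lt_two d))]
  omega

theorem isIntegerEncoding_binaryEncoding (d : ℕ) : IsIntegerEncoding (binaryEncoding d) := by
  refine isIntegerEncoding_of_zero_one (fun j k h => ?_) binaryEncoding_zero_or_one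
  have hd := Nat.le_pow_clog one_lt_two d
  exact Fin.ext (binaryCode_injOn (j.isLt.trans_le hd) (k.isLt.trans_le hd) h)

theorem isIntegerEncoding_integerEncoding (d : ℕ) : IsIntegerEncoding (integerEncoding d) := by
  have hZ := isIntegerEncoding_binaryEncoding d
  let e := LinearEquiv.ofInjectiveEndo (unzigzag (codeLength d)) (unzigzag_injective _)
  have hcoe : ⇑e = unzigzag (codeLength d) := rfl
  have hrows : rows (integerEncoding d) = e '' rows (binaryEncoding d) := by
    rw [rows, rows, ← Set.range_comp]
    exact congrArg Set.range (funext fun k => (unzigzag_binaryEncoding k).symm)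
  have hhull : convexHull ℝ (rows (integerEncoding d)) =
      e '' convexHull ℝ (rows (binaryEncoding d)) := by
    rw [hrows]
    exact ((unzigzag (codeLength d)).image_convexHull _).symm
  refine ⟨fun j k h => ?_, ?_, ?_⟩
  · apply hZ.distinct
    apply toReal_injective
    apply unzigzag_injective
    rw [unzigzag_binaryEncoding, unzigzag_binaryEncoding, h]
  · rw [hhull, ← image_extremePoints, hZ.convexPosition, hrows]
  · apply Set.Subset.antisymm
    · rintro _ ⟨hy, c, rfl⟩
      rw [hhull] at hy
      obtain ⟨z, hz, hzc⟩ := hy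
      -- Unimodularity: an integer image has an integer preimage, so the lattice condition
      -- transfers.
      have hint : ∀ i, z i ∈ (Int.castAddHom ℝ).range := by
        refine mem_of_unzigzag_mem _ z fun i => ⟨c i, ?_⟩
        exact (congrFun hzc i).symm
      choose b hb using hint
      rw [hrows, ← hzc]
      refine Set.mem_image_of_mem _ ?_
      rw [← hZ.latticeEmpty]
      exact ⟨hz, b, funext hb⟩
    · rintro _ ⟨k, rfl⟩
      exact ⟨subset_convexHull ℝ _ ⟨k, rfl⟩, integerEncoding d k, rfl⟩

/-! ### Embeddings of disjunctive constraints -/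

section Embedding

variable {V : Type*} [Fintype V] {d r : ℕ}

theorem convex_face (T : Set V) : Convex ℝ (face T) := by
  rintro x ⟨hx, hxT⟩ y ⟨hy, hyT⟩ a b ha hb hab
  refine ⟨convex_stdSimplex ℝ V hx hy ha hb hab, fun v hv => ?_⟩
  by_contra hvT
  exact hv (by simp [Function.notMem_support.1 fun h => hvT (hxT h),
    Function.notMem_support.1 fun h => hvT (hyT h)])

theorem snd_mem_convexHull_rows {T : Fin d → Set V} {H : Fin d → Fin r → ℤ}
    {p : (V → ℝ) × (Fin r → ℝ)} (hp : p ∈ embeddingHull T H) :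
    p.2 ∈ convexHull ℝ (rows H) := by
  have h : embedding T H ⊆
      (LinearMap.snd ℝ (V → ℝ) (Fin r → ℝ)) ⁻¹' convexHull ℝ (rows H) := by
    refine Set.iUnion_subset fun k => ?_
    rintro ⟨x, y⟩ ⟨-, rfl⟩
    exact subset_convexHull ℝ _ ⟨k, rfl⟩
  exact convexHull_min h ((convex_convexHull ℝ _).linear_preimage _) hp

/-- Since `H k` is extreme, a convex combination with positive weights lies over it only if both
points do. The condition defining `S` is therefore convex, and it holds on the embedding because the
rows are distinct. -/
theorem fst_mem_face {T : Fin d → Set V} {H : Fin d → Fin r → ℤ} (hH : IsIntegerEncoding H)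
    {p : (V → ℝ) × (Fin r → ℝ)} (hp : p ∈ embeddingHull T H) {k : Fin d}
    (hk : p.2 = toReal (H k)) : p.1 ∈ face (T k) := by
  let S : Set ((V → ℝ) × (Fin r → ℝ)) :=
    {q | q.2 ∈ convexHull ℝ (rows H) ∧ (q.2 = toReal (H k) → q.1 ∈ face (T k))}
  have hext : toReal (H k) ∈ (convexHull ℝ (rows H)).extremePoints ℝ := by
    rw [hH.convexPosition]
    exact ⟨k, rfl⟩
  have hS : Convex ℝ S := by
    rw [convex_iff_forall_pos]
    rintro q ⟨hq, hqf⟩ s ⟨hs, hsf⟩ a b ha hb hab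
    refine ⟨convex_convexHull ℝ _ hq hs ha.le hb.le hab, fun h => ?_⟩
    obtain ⟨h1, h2⟩ := (mem_extremePoints.1 hext).2 _ hq _ hs ⟨a, b, ha, hb, hab, h⟩
    exact convex_face _ (hqf h1) (hsf h2) ha.le hb.le hab
  have hsub : embedding T H ⊆ S := by
    refine Set.iUnion_subset fun j => ?_
    rintro ⟨x, y⟩ ⟨hx, rfl⟩
    refine ⟨subset_convexHull ℝ _ ⟨j, rfl⟩, fun h => ?_⟩
    rwa [← hH.distinct (toReal_injective h)]
  exact (convexHull_min hsub hS hp).2 hk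

theorem isIdealFormulationOf_disjunction {I : Type*} [Fintype I] {T : Fin d → Set V}
    {H : Fin d → Fin r → ℤ} (hH : IsIntegerEncoding H) (F : MIPFormulation V (Fin r) I)
    (hF : F.relaxation = embeddingHull T H) : F.IsIdealFormulationOf (disjunction T) := by
  refine ⟨Set.Subset.antisymm ?_ ?_, fun p hp j => ?_⟩
  · rintro _ ⟨p, ⟨hp, hint⟩, rfl⟩
    rw [hF] at hp
    choose c hc using hint
    have hrow : p.2 ∈ rows H := by
      rw [← hH.latticeEmpty]
      exact ⟨snd_mem_convexHull_rows hp, c, funext fun j => (hc j).symm⟩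
    obtain ⟨k, hk⟩ := hrow
    exact Set.mem_iUnion.2 ⟨k, fst_mem_face hH hp hk.symm⟩
  · intro x hx
    obtain ⟨k, hk⟩ := Set.mem_iUnion.1 hx
    refine ⟨(x, toReal (H k)), ⟨?_, fun j => ⟨H k j, rfl⟩⟩, rfl⟩
    rw [hF]
    exact subset_convexHull ℝ _ (Set.mem_iUnion.2 ⟨k, hk, rfl⟩)
  · rw [hF] at hp
    obtain ⟨k, -, hk⟩ := Set.mem_iUnion.1 (extremePoints_convexHull_subset hp)
    exact ⟨H k j, by rw [Set.mem_singleton_iff.1 hk]; rfl⟩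

end Embedding

theorem convex_relaxation {V J I : Type*} [Fintype V] [Fintype J] [Fintype I]
    (F : MIPFormulation V J I) : Convex ℝ F.relaxation := by
  rintro p ⟨hp, hpb, hpi⟩ q ⟨hq, hqb, hqi⟩ a b ha hb hab
  refine ⟨convex_stdSimplex ℝ V hp hq ha hb hab, fun j hj => ?_, fun i => ?_⟩
  · exact convex_Icc (0 : ℝ) 1 (hpb j hj) (hqb j hj) ha hb hab
  · have h1 := mul_le_mul_of_nonneg_left (hpi i) ha
    have h2 := mul_le_mul_of_nonneg_left (hqi i) hb
    have h3 : a * ((F.ineq i).c : ℝ) + b * ((F.ineq i).c : ℝ) = (F.ineq i).c := by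
      rw [← add_mul, hab, one_mul]
    unfold LinIneq.Holds
    simp only [Prod.fst_add, Prod.snd_add, Prod.smul_fst, Prod.smul_snd, Pi.add_apply,
      Pi.smul_apply, smul_eq_mul, mul_add, Finset.sum_add_distrib, mul_left_comm _ a,
      mul_left_comm _ b, ← Finset.mul_sum] at h1 h2 ⊢
    linarith

/-! ### The sequence `α` -/

theorem alpha_zero (d : ℕ) : alpha d 0 = integerCode (codeLength d) 1 := rfl

theorem alpha_last (d : ℕ) : alpha d (d + 1) = integerCode (codeLength d) d := by
  simp [alpha]

theorem alpha_of_le {d j : ℕ} (hj : 1 ≤ j) (hjd : j ≤ d) :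
    alpha d j = integerCode (codeLength d) j := by
  rw [alpha, if_neg (by omega), if_neg (by omega)]

theorem exists_alpha_succ_sub_eq_single {d j : ℕ} (hj : 1 ≤ j) (hjd : j < d) :
    ∃ i, alpha d (j + 1) - alpha d j = Pi.single i 1 := by
  rw [alpha_of_le hj hjd.le, alpha_of_le (by omega) hjd]
  exact exists_integerCode_succ_sub_eq_single hj (hjd.trans_le (Nat.le_pow_clog one_lt_two d))

theorem alpha_succ_sub_eq_range_single (d : ℕ) :
    {c | ∃ j : ℕ, 1 ≤ j ∧ j < d ∧ c = alpha d (j + 1) - alpha d j} =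
      Set.range (fun i => (Pi.single i 1 : Fin (codeLength d) → ℤ)) := by
  apply Set.Subset.antisymm
  · rintro _ ⟨j, hj, hjd, rfl⟩
    obtain ⟨i, hi⟩ := exists_alpha_succ_sub_eq_single hj hjd
    exact ⟨i, hi.symm⟩
  · rintro _ ⟨i, rfl⟩
    have hlt : 2 ^ (i : ℕ) < d := (Nat.lt_clog_iff_pow_lt one_lt_two).1 i.isLt
    have hpos : 1 ≤ 2 ^ (i : ℕ) := Nat.one_le_two_pow
    -- Column `i` first changes after row `2^i`, which is less than `d` by minimality of the code
    -- length, so truncation to `d` rows loses no unit vector.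
    refine ⟨2 ^ (i : ℕ), hpos, hlt, ?_⟩
    rw [alpha_of_le hpos hlt.le, alpha_of_le (by omega) hlt]
    have h := integerCode_succ_sub_eq_single (r := codeLength d) (a := i) (s := 0)
      (by simpa using hlt.trans_le (Nat.le_pow_clog one_lt_two d)) i.isLt
    simpa using h.symm

theorem alpha_le_integerEncoding {d : ℕ} {k : Fin d} {v : Fin (d + 1)} (hv : v ∈ sos2Family d k) :
    alpha d v ≤ integerEncoding d k := by
  have hk := k.isLt
  rcases hv with rfl | rfl
  · rcases Nat.eq_zero_or_pos (k : ℕ) with h | h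
    · simp [h, alpha_zero, integerEncoding]
    · rw [Fin.val_castSucc, alpha_of_le h hk.le]
      exact integerCode_mono _ (by omega)
  · rw [Fin.val_succ, alpha_of_le (by omega) hk]
    exact le_rfl

theorem integerEncoding_le_alpha_succ {d : ℕ} {k : Fin d} {v : Fin (d + 1)}
    (hv : v ∈ sos2Family d k) : integerEncoding d k ≤ alpha d ((v : ℕ) + 1) := by
  have hk := k.isLt
  rcases hv with rfl | rfl
  · rw [Fin.val_castSucc, alpha_of_le (by omega) hk]
    exact le_rfl
  · rw [Fin.val_succ]
    rcases Nat.lt_or_ge ((k : ℕ) + 1) d with h | h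
    · rw [alpha_of_le (by omega) h]
      exact integerCode_mono _ (by omega)
    · have hkd : (k : ℕ) + 1 = d := by omega
      rw [integerEncoding, hkd, alpha_last]

theorem exists_alpha_eq_integerEncoding {d : ℕ} (hd : 1 ≤ d) (v : Fin (d + 1)) :
    ∃ k, v ∈ sos2Family d k ∧ alpha d v = integerEncoding d k := by
  induction v using Fin.cases with
  | zero => exact ⟨⟨0, hd⟩, Or.inl rfl, rfl⟩
  | succ k =>
    refine ⟨k, Or.inr rfl, ?_⟩
    rw [Fin.val_succ, alpha_of_le (by omega) k.isLt]
    rfl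

theorem exists_alpha_succ_eq_integerEncoding {d : ℕ} (hd : 1 ≤ d) (v : Fin (d + 1)) :
    ∃ k, v ∈ sos2Family d k ∧ alpha d ((v : ℕ) + 1) = integerEncoding d k := by
  induction v using Fin.lastCases with
  | last =>
    obtain ⟨n, rfl⟩ : ∃ n, d = n + 1 := ⟨d - 1, by omega⟩
    exact ⟨Fin.last n, Or.inr rfl, by rw [Fin.val_last, alpha_last]; rfl⟩
  | cast k =>
    refine ⟨k, Or.inl rfl, ?_⟩
    rw [Fin.val_castSucc, alpha_of_le (by omega) k.isLt]
    rfl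

theorem alpha_succ_sub_eq_zero_or_single {d : ℕ} (hd : 1 ≤ d) (v : Fin (d + 1)) :
    alpha d ((v : ℕ) + 1) - alpha d v = 0 ∨
      ∃ i, alpha d ((v : ℕ) + 1) - alpha d v = Pi.single i 1 := by
  have hv := v.isLt
  rcases Nat.eq_zero_or_pos (v : ℕ) with h | h
  · left
    rw [h, alpha_zero, alpha_of_le le_rfl hd, sub_self]
  · rcases Nat.lt_or_ge (v : ℕ) d with h' | h'
    · exact Or.inr (exists_alpha_succ_sub_eq_single h h')
    · left
      rw [show (v : ℕ) = d by omega, alpha_last, alpha_of_le hd le_rfl, sub_self]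

/-! ### The relaxations -/

theorem single_mem_embedding {d : ℕ} {k : Fin d} {v : Fin (d + 1)} {r : ℕ}
    (hv : v ∈ sos2Family d k) (H : Fin d → Fin r → ℤ) :
    (Pi.single v 1, toReal (H k)) ∈ embedding (sos2Family d) H := by
  refine Set.mem_iUnion.2 ⟨k, ⟨single_mem_stdSimplex ℝ v, fun w hw => ?_⟩, rfl⟩
  by_contra hne
  exact hw (Pi.single_eq_of_ne (fun h => hne (by rwa [h])) _)

theorem embedding_subset_relaxation_ZZI (d : ℕ) :
    embedding (sos2Family d) (integerEncoding d) ⊆ (ZZI d).relaxation := by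
  refine Set.iUnion_subset fun k => ?_
  rintro ⟨x, y⟩ ⟨⟨hx, hsupp⟩, hy⟩
  simp only [Set.mem_singleton_iff] at hy
  subst hy
  rw [mem_relaxation_ZZI]
  refine ⟨hx, fun i => ?_⟩
  have hsum : toReal (integerEncoding d k) i =
      ∑ v, (integerEncoding d k i : ℝ) * x v := by
    rw [← Finset.mul_sum, hx.2, mul_one]
    rfl
  rw [hsum]
  constructor <;> refine Finset.sum_le_sum fun v _ => ?_ <;> by_cases hv : x v = 0
  · simp [hv]
  · exact mul_le_mul_of_nonneg_right
      (by exact_mod_cast alpha_le_integerEncoding (hsupp hv) i) (hx.1 v)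
  · simp [hv]
  · exact mul_le_mul_of_nonneg_right
      (by exact_mod_cast integerEncoding_le_alpha_succ (hsupp hv) i) (hx.1 v)

theorem single_interpolation_mem {d : ℕ} (hd : 1 ≤ d) (v : Fin (d + 1))
    {t : Fin (codeLength d) → ℝ} (ht : ∀ i, t i ∈ Set.Icc (0 : ℝ) 1) :
    (Pi.single v 1, fun i => (alpha d v i : ℝ) + t i * (alpha d ((v : ℕ) + 1) i - alpha d v i)) ∈
      embeddingHull (sos2Family d) (integerEncoding d) := by
  -- At most one coordinate of the difference is nonzero, so a single parameter replaces the
  -- coordinatewise ones.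
  obtain ⟨s, hs, h⟩ : ∃ s ∈ Set.Icc (0 : ℝ) 1, ∀ i,
      t i * ((alpha d ((v : ℕ) + 1) i : ℝ) - alpha d v i) =
        s * (alpha d ((v : ℕ) + 1) i - alpha d v i) := by
    have hcast : ∀ i, (alpha d ((v : ℕ) + 1) i : ℝ) - alpha d v i =
        ((alpha d ((v : ℕ) + 1) - alpha d v) i : ℤ) := fun i => by simp
    simp only [hcast]
    rcases alpha_succ_sub_eq_zero_or_single hd v with h | ⟨j, h⟩ <;> rw [h]
    · exact ⟨0, by simp, by simp⟩
    · refine ⟨t j, ht j, fun i => ?_⟩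
      by_cases hij : i = j
      · rw [hij]
      · simp [hij]
  obtain ⟨k, hk, hka⟩ := exists_alpha_eq_integerEncoding hd v
  obtain ⟨l, hl, hla⟩ := exists_alpha_succ_eq_integerEncoding hd v
  have hmem := convex_convexHull ℝ (embedding (sos2Family d) (integerEncoding d))
    (subset_convexHull ℝ _ (single_mem_embedding hk _))
    (subset_convexHull ℝ _ (single_mem_embedding hl _))
    (sub_nonneg.2 hs.2) hs.1 (sub_add_cancel 1 s)
  unfold embeddingHull
  convert hmem using 1
  refine Prod.ext ?_ (funext fun i => ?_)
  · simp [← add_smul]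
  · simp only [h, ← hka, ← hla, toReal, Prod.snd_add, Prod.smul_snd, Pi.add_apply, Pi.smul_apply,
      smul_eq_mul]
    ring

theorem exists_interpolation {a b y : ℝ} (h1 : a ≤ y) (h2 : y ≤ b) :
    ∃ t ∈ Set.Icc (0 : ℝ) 1, y = a + t * (b - a) := by
  have h : y ∈ segment ℝ a b := by
    rw [segment_eq_Icc (h1.trans h2)]
    exact ⟨h1, h2⟩
  rw [segment_eq_image'] at h
  obtain ⟨t, ht, rfl⟩ := h
  exact ⟨t, ht, rfl⟩

theorem relaxation_ZZI {d : ℕ} (hd : 1 ≤ d) :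
    (ZZI d).relaxation = embeddingHull (sos2Family d) (integerEncoding d) := by
  refine Set.Subset.antisymm ?_
    (convexHull_min (embedding_subset_relaxation_ZZI d) (convex_relaxation _))
  rintro ⟨x, y⟩ hxy
  rw [mem_relaxation_ZZI] at hxy
  obtain ⟨hx, hy⟩ := hxy
  -- Each `t i` is independent of the breakpoint, so the same `t` serves at every `v` and averaging
  -- with weights `x v` recovers `y`.
  choose t ht hyt using fun i => exists_interpolation (hy i).1 (hy i).2
  have hmem := (convex_convexHull ℝ (embedding (sos2Family d) (integerEncoding d))).sum_mem
    (t := Finset.univ) (fun v _ => hx.1 v) hx.2 (fun v _ => single_interpolation_mem hd v ht)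
  unfold embeddingHull
  convert hmem using 1
  refine Prod.ext (funext fun w => ?_) (funext fun i => ?_)
  · simp [Prod.fst_sum, Finset.sum_apply, Pi.single_apply]
  · simp only [Prod.snd_sum, Finset.sum_apply, Prod.smul_snd, Pi.smul_apply, smul_eq_mul]
    rw [hyt i, ← Finset.sum_sub_distrib, Finset.mul_sum, ← Finset.sum_add_distrib]
    exact Finset.sum_congr rfl fun v _ => by ring

theorem mem_relaxation_ZZB_iff (d : ℕ) (x : Fin (d + 1) → ℝ) (y : Fin (codeLength d) → ℝ) :
    (x, y) ∈ (ZZB d).relaxation ↔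
      (∀ i, 0 ≤ y i ∧ y i ≤ 1) ∧ (x, unzigzag _ y) ∈ (ZZI d).relaxation := by
  rw [mem_relaxation_ZZB, mem_relaxation_ZZI, and_left_comm]
  rfl

/-- `unzigzag` maps the binary embedding onto the integer one and is injective, so the hull of `ZZI`
pulls back to the hull for the binary code. The bounds on `y` hold there because the code is 0/1. -/
theorem relaxation_ZZB {d : ℕ} (hd : 1 ≤ d) :
    (ZZB d).relaxation = embeddingHull (sos2Family d) (binaryEncoding d) := by
  apply Set.Subset.antisymm
  · rintro ⟨x, y⟩ hxy
    rw [mem_relaxation_ZZB_iff, relaxation_ZZI hd] at hxy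
    let f := LinearMap.prodMap (LinearMap.id (R := ℝ) (M := Fin (d + 1) → ℝ))
      (unzigzag (codeLength d))
    have himage : embedding (sos2Family d) (integerEncoding d) =
        f '' embedding (sos2Family d) (binaryEncoding d) := by
      rw [embedding, embedding, Set.image_iUnion]
      refine Set.iUnion_congr fun k => ?_
      rw [LinearMap.coe_prodMap, Set.prodMap_image_prod, Set.image_singleton,
        unzigzag_binaryEncoding]
      simp
    have h := hxy.2
    rw [embeddingHull, himage, ← f.image_convexHull] at h
    obtain ⟨⟨x', y'⟩, hmem, heq⟩ := h
    obtain ⟨rfl, hy⟩ := Prod.ext_iff.1 heq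
    obtain rfl := unzigzag_injective _ hy
    exact hmem
  · refine convexHull_min (Set.iUnion_subset fun k => ?_) (convex_relaxation _)
    rintro ⟨x, y⟩ ⟨hx, hy⟩
    simp only [Set.mem_singleton_iff] at hy
    subst hy
    rw [mem_relaxation_ZZB_iff, unzigzag_binaryEncoding]
    refine ⟨fun i => ?_, embedding_subset_relaxation_ZZI d (Set.mem_iUnion.2 ⟨k, hx, rfl⟩)⟩
    rcases binaryEncoding_zero_or_one k i with h | h <;> simp [toReal, h]

theorem codeLength_eq_natCeil_logb (d : ℕ) : codeLength d = ⌈Real.logb 2 d⌉₊ := by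
  exact_mod_cast (Real.natCeil_logb_natCast 2 d).symm

end ZigZag

theorem proposition4 (d : ℕ) (hd : 1 ≤ d) :
    -- the two encodings
    ZigZag.IsIntegerEncoding (ZigZag.integerEncoding d) ∧
    ZigZag.IsIntegerEncoding (ZigZag.binaryEncoding d) ∧
    (∀ k i, ZigZag.binaryEncoding d k i = 0 ∨ ZigZag.binaryEncoding d k i = 1) ∧
    {c | ∃ j : ℕ, 1 ≤ j ∧ j < d ∧ c = ZigZag.alpha d (j + 1) - ZigZag.alpha d j} =
      Set.range (fun i => (Pi.single i 1 : Fin (ZigZag.codeLength d) → ℤ)) ∧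
    -- general integer zig-zag formulation
    (ZigZag.ZZI d).IsIdealFormulationOf (ZigZag.sos2 d) ∧
    (ZigZag.ZZI d).relaxation =
      ZigZag.embeddingHull (ZigZag.sos2Family d) (ZigZag.integerEncoding d) ∧
    (ZigZag.ZZI d).numIntegerVars = ⌈Real.logb 2 d⌉₊ ∧
    (ZigZag.ZZI d).numIneqs = 2 * ⌈Real.logb 2 d⌉₊ ∧
    -- binary zig-zag formulation
    (ZigZag.ZZB d).IsIdealFormulationOf (ZigZag.sos2 d) ∧
    (ZigZag.ZZB d).relaxation =
      ZigZag.embeddingHull (ZigZag.sos2Family d) (ZigZag.binaryEncoding d) ∧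
    (ZigZag.ZZB d).numIntegerVars = ⌈Real.logb 2 d⌉₊ ∧
    (ZigZag.ZZB d).numIneqs = 2 * ⌈Real.logb 2 d⌉₊ := by
  have hC := ZigZag.isIntegerEncoding_integerEncoding d
  have hZ := ZigZag.isIntegerEncoding_binaryEncoding d
  have hI := ZigZag.relaxation_ZZI hd
  have hB := ZigZag.relaxation_ZZB hd
  have hr := ZigZag.codeLength_eq_natCeil_logb d
  refine ⟨hC, hZ, ZigZag.binaryEncoding_zero_or_one, ZigZag.alpha_succ_sub_eq_range_single d,
    ZigZag.isIdealFormulationOf_disjunction hC _ hI, hI, ?_, ?_,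
    ZigZag.isIdealFormulationOf_disjunction hZ _ hB, hB, ?_, ?_⟩ <;>
  simp [ZigZag.MIPFormulation.numIntegerVars, ZigZag.MIPFormulation.numIneqs, ← hr, two_mul]
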